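/- Let $\mathcal A$ be a finite set of atoms and $(\mathcal Q,\le)$ a finite nonempty totally ordered set of weights. **Weighted sets.** For a set $\overline\Gamma$ of pairs (object, weight) let $\Gamma=\{x\mid (x,\alpha)\in\overline\Gamma\text{ for some }\alpha\}$. Write $\overline\Gamma_1\sqsubseteq\overline\Gamma_2$ if every $(x,\alpha)\in\overline\Gamma_1$ has some $(x,\beta)\in\overline\Gamma_2$ with $\alpha\le\beta$; let $\overline\Gamma_1\sqcup\overline\Gamma_2$ (and likewise the join of a family) be the union in which every object keeps only its greatest weight; and let $\overline\Gamma_1-\overline\Gamma_2$ consist of the $(x,\alpha)\in\overline\Gamma_1$ such that $x\notin\Gamma_2$ or $(x,\beta)\in\overline\Gamma_2$ for some $\beta<\alpha$. A *possibilistic interpretation* is a set $\overline I\subseteq\mathcal A\times\mathcal Q$ in which each atom has at most one weight. A (normal) *rule* $r$ is $p\leftarrow \mathit{Pos},\mathit{not}\,\mathit{Neg}$ with head $p\in\mathcal A$ and $\mathit{Pos},\mathit{Neg}\subseteq\mathcal A$; a *poss-NLP* is a set of weighted rules $(r,\alpha)$, $\alpha\in\mathcal Q$, in which each rule has at most one weight.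 **Semantics.** A weighted rule $(r,\alpha)$ is $\beta$-applicable in $\overline I$ if $\mathit{Pos}\subseteq I$, $\mathit{Neg}\cap I=\emptyset$ and $\beta$ is the minimum of $\alpha$ and the weights in $\overline I$ of the atoms of $\mathit{Pos}$. $\mathcal T_{\overline P}(\overline I)$ is the set of all $(q,\delta)$ such that some rule of $\overline P$ with head $q$ is applicable in $\overline I$ and $\delta$ is the largest $\beta$ for which a rule of $\overline P$ with head $q$ is $\beta$-applicable in $\overline I$. For a program $\overline P$ with all $\mathit{Neg}$ empty, $\mathit{Cn}(\overline P)=\bigsqcup_{n\ge0}\mathcal T_{\overline P}^n(\emptyset)$. The reduct of $\overline P$ w.r.t. $S\subseteq\mathcal A$ is $\overline P^S=\{(p\leftarrow \mathit{Pos},\alpha)\mid (p\leftarrow \mathit{Pos},\mathit{not}\,\mathit{Neg},\alpha)\in\overline P,\ \mathit{Neg}\cap S=\emptyset\}$ (similarly $P^S$ for unweighted programs), and $\mathit{PSM}(\overline P)=\{\overline S\mid\overline S=\mathit{Cn}(\overline P^{S})\}$ is the set of *poss-stable models*. $\overline I$ is *coherent* with $\overline P$ if $\mathcal T_{\overline P}(\overline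 I)\sqsubseteq\overline I$. $\overline I,\overline J$ are *comparable* if $I\subseteq J$ or $J\subseteq I$. An unweighted program without negation is *grounded* if it can be ordered as a sequence such that each body atom of each rule is the head of an earlier rule. **Induction tasks.** An induction task $T=\langle\overline B,E^+,E^-\rangle$ consists of a poss-NLP $\overline B$ and sets $E^+,E^-$ of possibilistic interpretations. A *solution* is a poss-NLP $\overline H$ with $E^+\subseteq\mathit{PSM}(\overline B\sqcup\overline H)$ and $E^-\cap\mathit{PSM}(\overline B\sqcup\overline H)=\emptyset$. A *minimal solution* is a solution such that no solution has fewer rules. **Solution spaces.** For $\epsilon=(p,\alpha)\in\overline I$ and $\star\in\{>,\ge,=\}$ let $RA^\star(\overline I,\alpha)=\{q\mid(q,\beta)\in\overline I,\ \beta\star\alpha\}$. - $S^+(\overline I,\epsilon)$ is the set of all $(p\leftarrow \mathit{Pos},\mathit{not}\,\mathit{Neg},\beta)$ with $\mathit{Pos}\subseteq RA^\ge(\overline I,\alpha)$, $\mathit{Neg}\subseteq\mathcal A\setminus I$, and $\beta=\alpha$ if $\mathit{Pos}\cap RA^=(\overline I,\alpha)=\emptyset$, $\beta\ge\alpha$ otherwise.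 $S^+(\overline I)$ is the set of all inclusion-minimal hitting sets of $\{S^+(\overline I,\epsilon)\mid\epsilon\in\overline I\}$. - $S^-(\overline I,\epsilon)$ is the set of all $(p\leftarrow \mathit{Pos},\mathit{not}\,\mathit{Neg},\beta)$ with $\mathit{Pos}\subseteq RA^>(\overline I,\alpha)$, $\mathit{Neg}\subseteq\mathcal A\setminus I$ and $\beta>\alpha$. $S^-(\overline I)$ is $\bigcup_{\epsilon\in\overline I}S^-(\overline I,\epsilon)$ together with all $(q\leftarrow \mathit{Pos},\mathit{not}\,\mathit{Neg},\beta)$ with $q\notin I$, $\mathit{Pos}\subseteq I$, $\mathit{Neg}\subseteq\mathcal A\setminus I$, $\beta\in\mathcal Q$. **Algorithm ILPSMmin** on input $T$: 1. Return **fail** if two different elements of $E^+$ are comparable; or some element of $E^+$ is not coherent with $\overline B$; or $E^-$ is incompatible with $\overline B$; or $E^+\cap E^-\ne\emptyset$. Here, with $\overline{\mathbb A}$ the set of possibilistic interpretations $\overline G$ with $G=\mathcal A$, *incompatible* means that the least set of atoms closed under the rules of $B^{\mathcal A}$ is $\mathcal A$, that $\overline{\mathbb A}\cap E^-\neq\emptyset$,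 and that no $\overline G\in\overline{\mathbb A}\setminus E^-$ is coherent with $\overline B$. 2. $\overline H\leftarrow\emptyset$; $\mathit{norm}\leftarrow|E^+|\cdot|\mathcal A|+|E^-|+1$; $\mathit{blacklist}\leftarrow\bigcup_{\overline I\in E^+}S^-(\overline I)$. For $\overline I\in E^+$ let $W_{\overline I}$ be the set of those $\overline P\in S^+(\overline I)$ with $\overline P\cap\mathit{blacklist}=\emptyset$ and $P^I$ grounded. If $E^+=\emptyset$ then $\mathit{seeds}\leftarrow\{\emptyset\}$; otherwise $\mathit{seeds}\leftarrow\{\bigsqcup_{\overline I\in E^+}Y_{\overline I}\mid Y_{\overline I}\in W_{\overline I}\}$ (with $Y_{\overline I}=\emptyset$ if $W_{\overline I}=\emptyset$). 3. For each $X\in\mathit{seeds}$, in any order: - If no $\overline e\in E^-$ is in $\mathit{PSM}(\overline B\sqcup X)$: if $|X-\overline B|<\mathit{norm}$, then $\overline H\leftarrow X-\overline B$ and $\mathit{norm}\leftarrow|\overline H|$. - Otherwise let $\overline E$ be the set of $\overline e\in E^-$ that are comparable with no element of $E^+$ and coherent with $\overline B\sqcup X$, and let $\mathit{whitelist}=\bigcup_{\overline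 e\in\overline E}S^-(\overline e)\setminus\mathit{blacklist}$. For $j=1,\dots,|\overline E|$ and for each poss-NLP $\overline P\subseteq\mathit{whitelist}$ with $|\overline P|=j$, in any order: if $|(X\sqcup\overline P)-\overline B|<\mathit{norm}$ (current value) and no $\overline e\in\overline E$ is in $\mathit{PSM}(\overline B\sqcup X\sqcup\overline P)$, then $\overline H\leftarrow(X\sqcup\overline P)-\overline B$ and $\mathit{norm}\leftarrow|\overline H|$. 4. Return $\overline H$. **Proposition (correctness of ILPSMmin).** For every induction task $T=\langle\overline B,E^+,E^-\rangle$ the algorithm ILPSMmin has a run that returns a value, and, whatever orders are chosen in the loops, it returns **fail** if and only if $T$ has no solution; otherwise it returns a minimal solution of $T$. -/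

import Mathlib

namespace PossLP

/-! ### Sets of weighted objects

Possibilistic atoms and possibilistic rules are pairs of an object and a weight. -/

section Weighted

variable {F Q : Type*}

/-- The classic projection: forget the weights. -/
def proj (G : Set (F × Q)) : Set F := {x | ∃ a, (x, a) ∈ G}

/-- Every object occurs with at most one weight. On sets of weighted atoms this is the notion of a
possibilistic interpretation, on sets of weighted rules that of a poss-NLP. -/
def Functional (G : Set (F × Q)) : Prop :=
  ∀ x a b, (x, a) ∈ G → (x, b) ∈ G → a = b

variable [LinearOrder Q]

/-- `G₁ ⊑ G₂`. -/
def Below (G₁ G₂ : Set (F × Q)) : Prop :=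
  ∀ x a, (x, a) ∈ G₁ → ∃ b, (x, b) ∈ G₂ ∧ a ≤ b

/-- `G₁ ⊔ G₂`. -/
def join (G₁ G₂ : Set (F × Q)) : Set (F × Q) :=
  {z | z ∈ G₁ ∧ z.1 ∉ proj G₂} ∪ {z | z ∈ G₂ ∧ z.1 ∉ proj G₁} ∪
    {z | ∃ a b, (z.1, a) ∈ G₁ ∧ (z.1, b) ∈ G₂ ∧ z.2 = max a b}

/-- The join `⊔` of a family: each object that occurs in some member of the family
is given its greatest weight. -/
def bigJoin {ι : Type*} (G : ι → Set (F × Q)) : Set (F × Q) :=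
  {z | IsGreatest {a | ∃ i, (z.1, a) ∈ G i} z.2}

/-- `G₁ - G₂`. -/
def diff (G₁ G₂ : Set (F × Q)) : Set (F × Q) :=
  {z | z ∈ G₁ ∧ z.1 ∉ proj G₂} ∪ {z | z ∈ G₁ ∧ ∃ b, (z.1, b) ∈ G₂ ∧ b < z.2}

end Weighted

/-! ### Classic normal rules and programs -/

/-- A classic normal rule `head ← pos, not neg`. -/
@[ext]
structure Rule (A : Type*) where
  head : A
  pos : Finset A
  neg : Finset A

section Classic

variable {A : Type*}

/-- The definite rule `head ← pos`. -/
def Rule.definitePart (r : Rule A) : Rule A := ⟨r.head, r.pos, ∅⟩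

/-- The reduct `P^S` of a normal logic program. -/
def reduct (P : Set (Rule A)) (S : Set A) : Set (Rule A) :=
  {d | ∃ r ∈ P, Disjoint (r.neg : Set A) S ∧ d = r.definitePart}

/-- The immediate consequence operator `T_P` of a definite program, a monotone map. -/
def consequence (P : Set (Rule A)) : Set A →o Set A where
  toFun S := {q | ∃ r ∈ P, (r.pos : Set A) ⊆ S ∧ r.head = q}
  monotone' := by
    rintro S S' h q ⟨r, hr, hpos, hq⟩
    exact ⟨r, hr, hpos.trans h, hq⟩

/-- A definite program is grounded if it can be ordered as a sequence in which every positive body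
atom of a rule is the head of an earlier rule. -/
def Grounded (P : Set (Rule A)) : Prop :=
  ∃ l : List (Rule A), l.Nodup ∧ (∀ r, r ∈ l ↔ r ∈ P) ∧
    ∀ i : Fin l.length, ∀ p ∈ (l.get i).pos, ∃ j : Fin l.length, j < i ∧ (l.get j).head = p

end Classic

/-! ### Possibilistic programs and possibilistic stable models -/

section Possibilistic

variable {A Q : Type*} [LinearOrder Q]

/-- The weighted rule `x` is `b`-applicable in `I`: every positive body atom occurs in `I`, no
negative body atom does, and `b` is the minimum of the weight of the rule and the weights of its
positive body atoms. -/
def Applicable (I : Set (A × Q)) (x : Rule A × Q) (b : Q) : Prop :=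
  (x.1.pos : Set A) ⊆ proj I ∧ Disjoint (x.1.neg : Set A) (proj I) ∧
    IsLeast ({x.2} ∪ {c | ∃ p ∈ x.1.pos, (p, c) ∈ I}) b

/-- The immediate possibilistic consequence operator of a program. -/
def possConsequence (P : Set (Rule A × Q)) (I : Set (A × Q)) : Set (A × Q) :=
  {z | IsGreatest {b | ∃ x ∈ P, x.1.head = z.1 ∧ Applicable I x b} z.2}

/-- `Cn(P)` for a possibilistic definite program `P`: the join of the iterates of the immediate
consequence operator from the empty set. -/
def Cn (P : Set (Rule A × Q)) : Set (A × Q) :=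
  bigJoin fun n : ℕ => (possConsequence P)^[n] ∅

/-- The possibilistic reduct `P^S`. -/
def possReduct (P : Set (Rule A × Q)) (S : Set A) : Set (Rule A × Q) :=
  {z | ∃ x ∈ P, Disjoint (x.1.neg : Set A) S ∧ z = (x.1.definitePart, x.2)}

/-- The set of possibilistic stable models of `P`. -/
def PSM (P : Set (Rule A × Q)) : Set (Set (A × Q)) :=
  {S | S = Cn (possReduct P (proj S))}

/-- Comparability of possibilistic interpretations. -/
def Comparable (I J : Set (A × Q)) : Prop := proj I ⊆ proj J ∨ proj J ⊆ proj I

/-- `I` is coherent with the program `P`. -/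
def Coherent (P : Set (Rule A × Q)) (I : Set (A × Q)) : Prop := Below (possConsequence P I) I

/-- The possibilistic interpretations in which every atom occurs. -/
def fullInterps (A Q : Type*) : Set (Set (A × Q)) := {I | Functional I ∧ proj I = Set.univ}

/-- The set `En` of interpretations is incompatible with the program `B`. -/
def Incompatible (B : Set (Rule A × Q)) (En : Set (Set (A × Q))) : Prop :=
  (consequence (reduct (proj B) Set.univ)).lfp = Set.univ ∧
  fullInterps A Q \ En ≠ fullInterps A Q ∧
  (fullInterps A Q \ En = ∅ ∨ ∀ G ∈ fullInterps A Q \ En, ¬ Coherent B G)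

end Possibilistic

/-! ### Induction tasks -/

/-- An induction task over the atoms `A` and the weights `Q`: a background poss-NLP and sets of
positive and negative examples, which are possibilistic interpretations. -/
structure Task (A Q : Type*) where
  B : Set (Rule A × Q)
  Epos : Set (Set (A × Q))
  Eneg : Set (Set (A × Q))
  functional_B : Functional B
  functional_Epos : ∀ I ∈ Epos, Functional I
  functional_Eneg : ∀ I ∈ Eneg, Functional I

section Solutions

variable {A Q : Type*} [LinearOrder Q]

/-- The poss-NLP `H` is a solution of the task. -/
def Task.IsSolution (T : Task A Q) (H : Set (Rule A × Q)) : Prop :=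
  Functional H ∧ T.Epos ⊆ PSM (join T.B H) ∧ T.Eneg ∩ PSM (join T.B H) = ∅

/-- A solution with the least number of rules. -/
def Task.IsMinimalSolution (T : Task A Q) (H : Set (Rule A × Q)) : Prop :=
  T.IsSolution H ∧ ¬ ∃ K, T.IsSolution K ∧ (proj K).ncard < (proj H).ncard

end Solutions

/-! ### Solution spaces -/

section Spaces

variable {A Q : Type*} [LinearOrder Q]

/-- `X` is a hitting set of the collection `C`. -/
def IsHittingSet {α : Type*} (C : Set (Set α)) (X : Set α) : Prop := ∀ Y ∈ C, (Y ∩ X).Nonempty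

/-- The set of all minimal hitting sets of the collection `C`. -/
def SMHS {α : Type*} (C : Set (Set α)) : Set (Set α) :=
  {X | IsHittingSet C X ∧ ¬ ∃ Y, Y ⊂ X ∧ IsHittingSet C Y}

/-- The atoms whose weight in `I` is greater than `a`. -/
def relGt (I : Set (A × Q)) (a : Q) : Set A := {p | ∃ b, (p, b) ∈ I ∧ b > a}

/-- The atoms whose weight in `I` is at least `a`. -/
def relGe (I : Set (A × Q)) (a : Q) : Set A := {p | ∃ b, (p, b) ∈ I ∧ b ≥ a}

/-- The atoms whose weight in `I` is `a`. -/
def relEq (I : Set (A × Q)) (a : Q) : Set A := {p | ∃ b, (p, b) ∈ I ∧ b = a}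

/-- The positive solution space `S⁺(I, e)` of a possibilistic atom `e = (p, a)`. -/
def posSpaceAt (I : Set (A × Q)) (e : A × Q) : Set (Rule A × Q) :=
  {x | x.1.head = e.1 ∧ (x.1.pos : Set A) ⊆ relGe I e.2 ∧ (x.1.neg : Set A) ⊆ (proj I)ᶜ ∧
    (((x.1.pos : Set A) ∩ relEq I e.2 = ∅ ∧ x.2 = e.2) ∨
      ((x.1.pos : Set A) ∩ relEq I e.2 ≠ ∅ ∧ x.2 ≥ e.2))}

/-- The positive solution space `S⁺(I)`, a collection of programs. -/
def posSpace (I : Set (A × Q)) : Set (Set (Rule A × Q)) :=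
  SMHS {Y | ∃ e ∈ I, Y = posSpaceAt I e}

/-- The negative solution space `S⁻(I, e)` of a possibilistic atom `e = (p, a)`. -/
def negSpaceAt (I : Set (A × Q)) (e : A × Q) : Set (Rule A × Q) :=
  {x | x.1.head = e.1 ∧ (x.1.pos : Set A) ⊆ relGt I e.2 ∧ (x.1.neg : Set A) ⊆ (proj I)ᶜ ∧
    x.2 > e.2}

/-- The negative solution space `S⁻(I)`, a set of weighted rules. -/
def negSpace (I : Set (A × Q)) : Set (Rule A × Q) :=
  (⋃ e ∈ I, negSpaceAt I e) ∪
    {x | x.1.head ∉ proj I ∧ (x.1.pos : Set A) ⊆ proj I ∧ (x.1.neg : Set A) ⊆ (proj I)ᶜ}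

end Spaces

/-! ### Loops of nondeterministic imperative programs

A statement is a relation between the state before and the state after its execution. -/

section Loops

variable {α σ : Type*}

/-- Execute `body` for the elements of a list, in the order of the list. -/
def ForList (body : α → σ → σ → Prop) : List α → σ → σ → Prop
  | [], s, t => t = s
  | a :: l, s, t => ∃ u, body a s u ∧ ForList body l u t

/-- Execute `body` once for every element of the set `S`, in an arbitrary order. -/
def ForEach (body : α → σ → σ → Prop) (S : Set α) (s t : σ) : Prop :=
  ∃ l : List α, l.Nodup ∧ (∀ a, a ∈ l ↔ a ∈ S) ∧ ForList body l s t

end Loops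

/-! ### The algorithm ILPSMmin -/

/-- The two program variables that are updated in the main loop. -/
structure State (A Q : Type*) where
  hyp : Set (Rule A × Q)
  norm : ℕ

namespace Task

variable {A Q : Type*} [LinearOrder Q]

open Classical in
/-- The existence test. -/
noncomputable def existence (T : Task A Q) : Bool :=
  if ∃ I ∈ T.Epos, ∃ J ∈ T.Epos, I ≠ J ∧ Comparable I J then false
  else if ∃ I ∈ T.Epos, ¬ Coherent T.B I then false
  else if Incompatible T.B T.Eneg then false
  else if T.Epos ∩ T.Eneg ≠ ∅ then false
  else true

/-- The rules that would destroy a positive example. -/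
def blacklist (T : Task A Q) : Set (Rule A × Q) := ⋃ I ∈ T.Epos, negSpace I

/-- The programs that support the positive example `I`. -/
def supports (T : Task A Q) (I : Set (A × Q)) : Set (Set (Rule A × Q)) :=
  {P | P ∈ posSpace I ∧ P ∩ T.blacklist = ∅ ∧ Grounded (reduct (proj P) (proj I))}

/-- The joins of one supporting program for each positive example (the empty program standing in
when there is no supporting one); only the empty program if there is no positive example. -/
def seeds (T : Task A Q) : Set (Set (Rule A × Q)) :=
  {X | (T.Epos = ∅ ∧ X = ∅) ∨ (T.Epos ≠ ∅ ∧ ∃ Y : T.Epos → Set (Rule A × Q),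
    (∀ I : T.Epos, Y I ∈ T.supports I ∨ (T.supports I = ∅ ∧ Y I = ∅)) ∧ X = bigJoin Y)}

/-- The negative examples that are incomparable with every positive example and coherent with the
background knowledge joined with `X`. -/
def critical (T : Task A Q) (X : Set (Rule A × Q)) : Set (Set (A × Q)) :=
  {e | e ∈ T.Eneg ∧ (∀ I ∈ T.Epos, ¬ Comparable e I) ∧ Coherent (join T.B X) e}

/-- The rules that block a critical negative example and are not blacklisted. -/
def whitelist (T : Task A Q) (X : Set (Rule A × Q)) : Set (Rule A × Q) :=
  {x | ∃ e ∈ T.critical X, x ∈ negSpace e ∧ x ∉ T.blacklist}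

/-- The poss-NLPs with exactly `j` rules, all of them in the whitelist. -/
def patches (T : Task A Q) (X : Set (Rule A × Q)) (j : ℕ) : Set (Set (Rule A × Q)) :=
  {P | Functional P ∧ P ⊆ T.whitelist X ∧ P.ncard = j}

open Classical in
/-- Body of the loop over the patches `P` of the seed `X`. -/
def patchStep (T : Task A Q) (X P : Set (Rule A × Q)) (s t : State A Q) : Prop :=
  t = if (diff (join X P) T.B).ncard < s.norm ∧
        ∀ e ∈ T.critical X, e ∉ PSM (join (join T.B X) P)
      then ⟨diff (join X P) T.B, (diff (join X P) T.B).ncard⟩ else s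

open Classical in
/-- Body of the loop over the seeds `X`. -/
def seedStep (T : Task A Q) (X : Set (Rule A × Q)) (s t : State A Q) : Prop :=
  if ∀ e ∈ T.Eneg, e ∉ PSM (join T.B X) then
    t = if (diff X T.B).ncard < s.norm then ⟨diff X T.B, (diff X T.B).ncard⟩ else s
  else
    ForList (fun j => ForEach (T.patchStep X) (T.patches X j))
      (List.range' 1 (T.critical X).ncard) s t

/-- The initial state. The start value of `norm` is larger by one than the largest number of rules
that a minimal solution may need, as the comparisons with `norm` are strict. -/
noncomputable def initial (T : Task A Q) : State A Q :=
  ⟨∅, T.Epos.ncard * Nat.card A + T.Eneg.ncard + 1⟩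

/-- Some run of the algorithm ILPSMmin on the task returns `out`, where `none` stands for the
answer "fail". Runs differ in the orders in which seeds and patches are enumerated. -/
def Returns (T : Task A Q) (out : Option (Set (Rule A × Q))) : Prop :=
  if T.existence then ∃ s, ForEach T.seedStep T.seeds T.initial s ∧ out = some s.hyp
  else out = none

end Task

end PossLP

/-!
Everything is read on level cuts. For a possibilistic interpretation `I`, the cut `relGe I b` is the
set of the atoms of weight at least `b`, and the level cuts of `Cn` of a reduct are the classic
consequences of the rules of weight at least `b` (`mem_relGe_Cn`). Hence `I` is poss-stable for `P`
iff it is coherent with `P` and each of its weighted atoms is derivable at its level in the reduct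
(`mem_PSM_iff`). Coherence means that `P` contains no rule of `S⁻(I)`
(`coherent_iff_disjoint_negSpace`), so it is inherited by smaller programs. Support is inherited by
larger programs, and a coherent program supports `I` iff it contains a grounded minimal hitting set
from `S⁺(I)` (`supported_of_mem_posSpace`, `exists_grounded_of_mem_PSM`). Two poss-stable models of
one program are never comparable unless they are equal.

The existence test is necessary because a solution inherits from these facts all its clauses
(`existence_of_isSolution`). It is sufficient because a positive example can be supported by rules
whose negative body consists of all the atoms outside of the example, and a negative example that
omits an atom can be blocked by rules whose body holds in no interpretation with other atoms; the
incompatibility clause deals with the negative examples that omit no atom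
(`exists_isSolution_of_existence`).

Every hypothesis that the loops accept is a solution: seeds support the positive examples, the
blacklist protects them, and a negative example that is not critical cannot be poss-stable
(`isSolution_diff`, `isSolution_of_critical`). Conversely, let `H` be a solution. Its join with the
background contains a seed, and if the seed alone is not accepted, it also contains an accepted
patch with at most one rule for each critical negative example (`exists_seed_subset`,
`exists_patch_subset`). The part of the seed and patch that exceeds the background lies in `H` and
has fewer rules than the start value of `norm`. As `norm` never grows, the final hypothesis has no
more rules than `H` (`isMinimalSolution_of_forEach`).
-/

namespace PossLP

/-! ### Weighted sets and their level cuts -/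

section Weighted

variable {F Q : Type*}

theorem Functional.mono {G H : Set (F × Q)} (hH : Functional H) (h : G ⊆ H) : Functional G :=
  fun x a b ha hb => hH x a b (h ha) (h hb)

theorem Functional.ncard_proj {G : Set (F × Q)} (hG : Functional G) :
    (proj G).ncard = G.ncard := by
  have : proj G = Prod.fst '' G := by
    ext x; simp [proj]
  rw [this]
  refine Set.InjOn.ncard_image ?_
  rintro ⟨x, a⟩ ha ⟨y, b⟩ hb (rfl : x = y)
  rw [hG x a b ha hb]

variable [LinearOrder Q]

theorem relGe_subset_proj (I : Set (F × Q)) (b : Q) : relGe I b ⊆ proj I :=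
  fun _ ⟨c, hc, _⟩ => ⟨c, hc⟩

theorem mem_relGe_self {I : Set (F × Q)} {p : F} {a : Q} (h : (p, a) ∈ I) : p ∈ relGe I a :=
  ⟨a, h, le_rfl⟩

theorem Functional.le_of_mem_relGe {I : Set (F × Q)} (hI : Functional I) {p : F} {a b : Q}
    (h : (p, a) ∈ I) (hb : p ∈ relGe I b) : b ≤ a := by
  obtain ⟨c, hc, hbc⟩ := hb
  exact hI p a c h hc ▸ hbc

theorem below_iff_relGe {G H : Set (F × Q)} : Below G H ↔ ∀ b, relGe G b ⊆ relGe H b := by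
  constructor
  · rintro h b x ⟨c, hc, hbc⟩
    obtain ⟨d, hd, hcd⟩ := h x c hc
    exact ⟨d, hd, le_trans hbc hcd⟩
  · intro h x a hx
    exact h a (mem_relGe_self hx)

theorem below_of_subset {G H : Set (F × Q)} (h : G ⊆ H) : Below G H :=
  fun _ a hx => ⟨a, h hx, le_rfl⟩

theorem Below.trans {G H K : Set (F × Q)} (h : Below G H) (h' : Below H K) : Below G K := by
  rw [below_iff_relGe] at *
  exact fun b => (h b).trans (h' b)

theorem Below.antisymm {G H : Set (F × Q)} (hG : Functional G) (hH : Functional H)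
    (h : Below G H) (h' : Below H G) : G = H := by
  have key : ∀ {G H : Set (F × Q)}, Functional G → Below G H → Below H G → G ⊆ H := by
    rintro G H hG h h' ⟨x, a⟩ hx
    obtain ⟨b, hb, hab⟩ := h x a hx
    obtain ⟨c, hc, hbc⟩ := h' x b hb
    obtain rfl := hG x a c hx hc
    exact le_antisymm hab hbc ▸ hb
  exact (key hG h h').antisymm (key hH h' h)

/-- A weighted set with unique weights is determined by its level cuts. -/
theorem Functional.ext_relGe {G H : Set (F × Q)} (hG : Functional G) (hH : Functional H)
    (h : ∀ b, relGe G b = relGe H b) : G = H :=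
  Below.antisymm hG hH (below_iff_relGe.2 fun b => (h b).subset)
    (below_iff_relGe.2 fun b => (h b).superset)

theorem functional_bigJoin {ι : Type*} (G : ι → Set (F × Q)) : Functional (bigJoin G) :=
  fun _ _ _ ha hb => IsGreatest.unique ha hb

theorem bigJoin_subset_iUnion {ι : Type*} (G : ι → Set (F × Q)) : bigJoin G ⊆ ⋃ i, G i := by
  rintro ⟨x, a⟩ ⟨⟨i, hi⟩, -⟩
  exact Set.mem_iUnion.2 ⟨i, hi⟩

theorem exists_isGreatest [Finite Q] {s : Set Q} (h : s.Nonempty) : ∃ a, IsGreatest s a := by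
  obtain ⟨a, ha⟩ := s.toFinite.exists_maximal h
  exact ⟨a, ha.prop, fun b hb => (le_total b a).elim id fun hab => ha.le_of_ge hb hab⟩

theorem exists_isLeast [Finite Q] {s : Set Q} (h : s.Nonempty) : ∃ a, IsLeast s a :=
  exists_isGreatest (Q := Qᵒᵈ) h

theorem below_bigJoin [Finite Q] {ι : Type*} (G : ι → Set (F × Q)) (i : ι) :
    Below (G i) (bigJoin G) := by
  intro x a hx
  obtain ⟨b, hb⟩ := exists_isGreatest (s := {a | ∃ i, (x, a) ∈ G i}) ⟨a, i, hx⟩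
  exact ⟨b, hb, hb.2 ⟨i, hx⟩⟩

theorem mem_relGe_bigJoin [Finite Q] {ι : Type*} {G : ι → Set (F × Q)} {b : Q} {x : F} :
    x ∈ relGe (bigJoin G) b ↔ ∃ i, x ∈ relGe (G i) b := by
  constructor
  · rintro ⟨c, hc, hbc⟩
    obtain ⟨i, hi⟩ := Set.mem_iUnion.1 (bigJoin_subset_iUnion G hc)
    exact ⟨i, c, hi, hbc⟩
  · rintro ⟨i, hi⟩
    exact below_iff_relGe.1 (below_bigJoin G i) b hi

theorem join_subset_union (G H : Set (F × Q)) : join G H ⊆ G ∪ H := by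
  rintro ⟨x, c⟩ ((h | h) | ⟨a, b, ha, hb, rfl : c = max a b⟩)
  · exact Or.inl h.1
  · exact Or.inr h.1
  · rcases max_choice a b with h | h <;> rw [h]
    exacts [Or.inl ha, Or.inr hb]

theorem below_join_left (G H : Set (F × Q)) : Below G (join G H) := by
  intro x a hx
  by_cases h : x ∈ proj H
  · obtain ⟨b, hb⟩ := h
    exact ⟨max a b, Or.inr ⟨a, b, hx, hb, rfl⟩, le_max_left a b⟩
  · exact ⟨a, Or.inl (Or.inl ⟨hx, h⟩), le_rfl⟩

theorem below_join_right (G H : Set (F × Q)) : Below H (join G H) := by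
  intro x b hx
  by_cases h : x ∈ proj G
  · obtain ⟨a, ha⟩ := h
    exact ⟨max a b, Or.inr ⟨a, b, ha, hx, rfl⟩, le_max_right a b⟩
  · exact ⟨b, Or.inl (Or.inr ⟨hx, h⟩), le_rfl⟩

theorem relGe_union (G H : Set (F × Q)) (b : Q) : relGe (G ∪ H) b = relGe G b ∪ relGe H b := by
  ext x
  constructor
  · rintro ⟨c, hc | hc, h⟩
    exacts [Or.inl ⟨c, hc, h⟩, Or.inr ⟨c, hc, h⟩]
  · rintro (⟨c, hc, h⟩ | ⟨c, hc, h⟩)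
    exacts [⟨c, Or.inl hc, h⟩, ⟨c, Or.inr hc, h⟩]

theorem relGe_join (G H : Set (F × Q)) (b : Q) : relGe (join G H) b = relGe G b ∪ relGe H b := by
  refine Set.Subset.antisymm ?_ (Set.union_subset (below_iff_relGe.1 (below_join_left G H) b)
    (below_iff_relGe.1 (below_join_right G H) b))
  rw [← relGe_union]
  exact below_iff_relGe.1 (below_of_subset (join_subset_union G H)) b

theorem join_below {G H K : Set (F × Q)} (hG : Below G K) (hH : Below H K) :
    Below (join G H) K := by
  rw [below_iff_relGe] at *
  exact fun b => relGe_join G H b ▸ Set.union_subset (hG b) (hH b)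

theorem Functional.join {G H : Set (F × Q)} (hG : Functional G) (hH : Functional H) :
    Functional (join G H) := by
  have fst : ∀ {x a}, (x, a) ∈ G → x ∈ proj G := fun h => ⟨_, h⟩
  have snd : ∀ {x a}, (x, a) ∈ H → x ∈ proj H := fun h => ⟨_, h⟩
  rintro x a b ((⟨h, n⟩ | ⟨h, n⟩) | ⟨c, d, hc, hd, e⟩)
    ((⟨h', n'⟩ | ⟨h', n'⟩) | ⟨c', d', hc', hd', e'⟩)
  · exact hG x a b h h'
  · exact absurd (fst h) n'
  · exact absurd (snd hd') n
  · exact absurd (fst h') n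
  · exact hH x a b h h'
  · exact absurd (fst hc') n
  · exact absurd (snd hd) n'
  · exact absurd (fst hc) n'
  · obtain rfl := hG x c c' hc hc'
    obtain rfl := hH x d d' hd hd'
    exact e.trans e'.symm

theorem join_assoc {G H K : Set (F × Q)} (hG : Functional G) (hH : Functional H)
    (hK : Functional K) : join (join G H) K = join G (join H K) :=
  ((hG.join hH).join hK).ext_relGe (hG.join (hH.join hK)) fun b => by
    simp only [relGe_join, Set.union_assoc]

theorem diff_subset (X B : Set (F × Q)) : diff X B ⊆ X := by
  rintro z (h | h) <;> exact h.1

theorem join_diff {B X : Set (F × Q)} (hB : Functional B) (hX : Functional X) :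
    join B (diff X B) = join B X := by
  refine Below.antisymm (hB.join (hX.mono (diff_subset X B))) (hB.join hX)
    (join_below (below_join_left _ _)
      ((below_of_subset (diff_subset X B)).trans (below_join_right _ _)))
    (join_below (below_join_left _ _) ?_)
  intro x a hx
  by_cases h : x ∈ proj B ∧ ∀ b, (x, b) ∈ B → a ≤ b
  · obtain ⟨⟨b, hb⟩, h⟩ := h
    obtain ⟨c, hc, hbc⟩ := below_join_left B (diff X B) x b hb
    exact ⟨c, hc, (h b hb).trans hbc⟩
  · refine below_join_right B (diff X B) x a ?_
    by_cases h' : x ∈ proj B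
    · push Not at h
      exact Or.inr ⟨hx, h h'⟩
    · exact Or.inl ⟨hx, h'⟩

theorem diff_subset_of_subset_join {B H X : Set (F × Q)} (hB : Functional B)
    (hX : X ⊆ join B H) : diff X B ⊆ H := by
  rintro ⟨x, a⟩ hx
  rcases join_subset_union B H (hX (diff_subset X B hx)) with h | h
  · rcases hx with ⟨-, hn⟩ | ⟨-, b, hb, hlt⟩
    · exact absurd ⟨a, h⟩ hn
    · exact absurd (hB x a b h hb) hlt.ne'
  · exact h

end Weighted

/-! ### Derivations at a fixed level -/

section Semantics

variable {A Q : Type*} [LinearOrder Q]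

/-- Derivability of an atom in the reduct of `P` with respect to `S`, using only rules of weight at
least `b`. -/
inductive Derivable (P : Set (Rule A × Q)) (S : Set A) (b : Q) : A → Prop
  | step (x : Rule A × Q) (mem : x ∈ P) (neg : Disjoint (x.1.neg : Set A) S) (le : b ≤ x.2)
      (pos : ∀ p ∈ x.1.pos, Derivable P S b p) : Derivable P S b x.1.head

theorem Derivable.mono {P R : Set (Rule A × Q)} {S S' : Set A} {b c : Q} {q : A} (hP : Below P R)
    (hS : S' ⊆ S) (hb : c ≤ b) (h : Derivable P S b q) : Derivable R S' c q := by
  induction h with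
  | step x mem neg le pos ih =>
    obtain ⟨w, hw, hle⟩ := hP x.1 x.2 mem
    exact .step (x.1, w) hw (neg.mono_right hS) (hb.trans (le.trans hle)) ih

theorem exists_degree [Finite Q] (I : Set (A × Q)) (x : Rule A × Q) :
    ∃ b, IsLeast ({x.2} ∪ {c | ∃ p ∈ x.1.pos, (p, c) ∈ I}) b :=
  exists_isLeast ⟨x.2, Or.inl rfl⟩

theorem functional_possConsequence (P : Set (Rule A × Q)) (I : Set (A × Q)) :
    Functional (possConsequence P I) :=
  fun _ _ _ ha hb => IsGreatest.unique ha hb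

/-- On level cuts, the possibilistic consequence operator is the classic one for the rules of
sufficient weight. -/
theorem mem_relGe_possConsequence [Finite Q] {P : Set (Rule A × Q)} {I : Set (A × Q)}
    (hI : Functional I) {b : Q} {q : A} :
    q ∈ relGe (possConsequence P I) b ↔ ∃ x ∈ P, x.1.head = q ∧
      Disjoint (x.1.neg : Set A) (proj I) ∧ b ≤ x.2 ∧ (x.1.pos : Set A) ⊆ relGe I b := by
  constructor
  · rintro ⟨c, ⟨⟨x, hx, hq, hpos, hneg, hc⟩, -⟩, hbc⟩
    refine ⟨x, hx, hq, hneg, le_trans hbc (hc.2 (Or.inl rfl)), fun p hp => ?_⟩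
    obtain ⟨d, hd⟩ := hpos hp
    exact ⟨d, hd, le_trans hbc (hc.2 (Or.inr ⟨p, hp, hd⟩))⟩
  · rintro ⟨x, hx, hq, hneg, hb, hpos⟩
    obtain ⟨d, hd⟩ := exists_degree I x
    obtain ⟨g, hg⟩ := exists_isGreatest (s := {b | ∃ x ∈ P, x.1.head = q ∧ Applicable I x b})
      ⟨d, x, hx, hq, hpos.trans (relGe_subset_proj I b), hneg, hd⟩
    refine ⟨g, hg, le_trans ?_
      (hg.2 ⟨x, hx, hq, hpos.trans (relGe_subset_proj I b), hneg, hd⟩)⟩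
    rcases hd.1 with h | ⟨p, hp, h⟩
    · exact h ▸ hb
    · exact hI.le_of_mem_relGe h (hpos hp)

theorem mem_relGe_possConsequence_possReduct [Finite Q] {P : Set (Rule A × Q)} {S : Set A}
    {I : Set (A × Q)} (hI : Functional I) {b : Q} {q : A} :
    q ∈ relGe (possConsequence (possReduct P S) I) b ↔ ∃ x ∈ P, x.1.head = q ∧
      Disjoint (x.1.neg : Set A) S ∧ b ≤ x.2 ∧ (x.1.pos : Set A) ⊆ relGe I b := by
  rw [mem_relGe_possConsequence hI]
  constructor
  · rintro ⟨_, ⟨x, hx, hneg, rfl⟩, hq, -, hb, hpos⟩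
    exact ⟨x, hx, hq, hneg, hb, hpos⟩
  · rintro ⟨x, hx, hq, hneg, hb, hpos⟩
    exact ⟨_, ⟨x, hx, hneg, rfl⟩, hq, by simp [Rule.definitePart], hb, hpos⟩

theorem functional_iterate (P : Set (Rule A × Q)) (n : ℕ) :
    Functional ((possConsequence P)^[n] ∅) := by
  cases n with
  | zero => exact fun _ _ _ h => h.elim
  | succ n =>
    rw [Function.iterate_succ_apply']
    exact functional_possConsequence _ _

theorem relGe_iterate_mono [Finite Q] (P : Set (Rule A × Q)) (S : Set A) (b : Q) :
    Monotone fun n => relGe ((possConsequence (possReduct P S))^[n] ∅) b := by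
  refine monotone_nat_of_le_succ fun n => ?_
  induction n with
  | zero =>
    rintro x ⟨c, hc, -⟩
    exact hc.elim
  | succ n ih =>
    intro q hq
    rw [Function.iterate_succ_apply', mem_relGe_possConsequence_possReduct
      (functional_iterate _ _)] at hq ⊢
    obtain ⟨x, hx, hq, hneg, hb, hpos⟩ := hq
    exact ⟨x, hx, hq, hneg, hb, hpos.trans ih⟩

/-- The level cuts of `Cn` of a reduct consist of the atoms derivable at that level. -/
theorem mem_relGe_Cn [Finite Q] {P : Set (Rule A × Q)} {S : Set A} {b : Q} {q : A} :
    q ∈ relGe (Cn (possReduct P S)) b ↔ Derivable P S b q := by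
  rw [Cn, mem_relGe_bigJoin]
  constructor
  · rintro ⟨n, hn⟩
    induction n generalizing q with
    | zero =>
      obtain ⟨c, hc, -⟩ := hn
      exact hc.elim
    | succ n ih =>
      rw [Function.iterate_succ_apply', mem_relGe_possConsequence_possReduct
        (functional_iterate _ _)] at hn
      obtain ⟨x, hx, rfl, hneg, hb, hpos⟩ := hn
      exact .step x hx hneg hb fun p hp => ih (hpos hp)
  · intro h
    induction h with
    | step x hx hneg hb _ ih =>
      choose! n hn using ih
      refine ⟨x.1.pos.sup n + 1, ?_⟩
      rw [Function.iterate_succ_apply', mem_relGe_possConsequence_possReduct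
        (functional_iterate _ _)]
      exact ⟨x, hx, rfl, hneg, hb, fun p hp =>
        relGe_iterate_mono P S b (Finset.le_sup (f := n) hp) (hn p hp)⟩

theorem functional_Cn (P : Set (Rule A × Q)) : Functional (Cn P) :=
  functional_bigJoin _

/-- Every weighted atom of `I` is derivable at its level in the reduct of `P` with respect
to `I`. -/
def Supported (P : Set (Rule A × Q)) (I : Set (A × Q)) : Prop :=
  ∀ p a, (p, a) ∈ I → Derivable P (proj I) a p

theorem Supported.mono {P R : Set (Rule A × Q)} {I : Set (A × Q)} (h : Supported P I)
    (hP : Below P R) : Supported R I :=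
  fun p a hp => (h p a hp).mono hP le_rfl le_rfl

/-- Coherence, read on level cuts. -/
theorem coherent_iff [Finite Q] {P : Set (Rule A × Q)} {I : Set (A × Q)} (hI : Functional I) :
    Coherent P I ↔ ∀ x ∈ P, Disjoint (x.1.neg : Set A) (proj I) → ∀ b ≤ x.2,
      (x.1.pos : Set A) ⊆ relGe I b → x.1.head ∈ relGe I b := by
  rw [Coherent, below_iff_relGe]
  constructor
  · intro h x hx hneg b hb hpos
    exact h b ((mem_relGe_possConsequence hI).2 ⟨x, hx, rfl, hneg, hb, hpos⟩)
  · intro h b q hq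
    obtain ⟨x, hx, rfl, hneg, hb, hpos⟩ := (mem_relGe_possConsequence hI).1 hq
    exact h x hx hneg b hb hpos

theorem Coherent.of_below [Finite Q] {P R : Set (Rule A × Q)} {I : Set (A × Q)}
    (hI : Functional I) (h : Coherent R I) (hP : Below P R) : Coherent P I := by
  rw [coherent_iff hI] at h ⊢
  intro x hx hneg b hb hpos
  obtain ⟨w, hw, hle⟩ := hP x.1 x.2 hx
  exact h (x.1, w) hw hneg b (hb.trans hle) hpos

/-- The rules of `S⁻(I)` are exactly those that violate coherence of `I`. -/
theorem coherent_iff_disjoint_negSpace [Finite Q] {P : Set (Rule A × Q)} {I : Set (A × Q)}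
    (hI : Functional I) : Coherent P I ↔ Disjoint P (negSpace I) := by
  rw [coherent_iff hI, Set.disjoint_left]
  constructor
  · rintro h x hx (hn | ⟨hhead, hpos, hneg⟩)
    · obtain ⟨⟨p, a⟩, hpa, rfl, hpos, hneg, hgt⟩ := Set.mem_iUnion₂.1 hn
      obtain ⟨d, hd⟩ := exists_degree I x
      have hda : a < d := by
        rcases hd.1 with h | ⟨q, hq, h⟩
        · exact h ▸ hgt
        · obtain ⟨c, hc, hac⟩ := hpos hq
          exact hI q c d hc h ▸ hac
      refine absurd (hI.le_of_mem_relGe hpa (h x hx (Set.subset_compl_iff_disjoint_right.1 hneg) d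
        (hd.2 (Or.inl rfl)) fun q hq => ?_)) hda.not_ge
      obtain ⟨c, hc, -⟩ := hpos hq
      exact ⟨c, hc, hd.2 (Or.inr ⟨q, hq, hc⟩)⟩
    · obtain ⟨d, hd⟩ := exists_degree I x
      refine hhead (relGe_subset_proj I d (h x hx (Set.subset_compl_iff_disjoint_right.1 hneg) d
        (hd.2 (Or.inl rfl)) fun q hq => ?_))
      obtain ⟨c, hc⟩ := hpos hq
      exact ⟨c, hc, hd.2 (Or.inr ⟨q, hq, hc⟩)⟩
  · intro h x hx hneg b hb hpos
    by_contra hhead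
    refine h hx ?_
    by_cases hp : x.1.head ∈ proj I
    · obtain ⟨a, ha⟩ := hp
      have hab : a < b := lt_of_not_ge fun hba => hhead ⟨a, ha, hba⟩
      refine Or.inl (Set.mem_iUnion₂.2 ⟨(x.1.head, a), ha, rfl, fun p hp => ?_,
        Set.subset_compl_iff_disjoint_right.2 hneg, lt_of_lt_of_le hab hb⟩)
      obtain ⟨c, hc, hbc⟩ := hpos hp
      exact ⟨c, hc, lt_of_lt_of_le hab hbc⟩
    · exact Or.inr ⟨hp, hpos.trans (relGe_subset_proj I b),
        Set.subset_compl_iff_disjoint_right.2 hneg⟩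

/-- Poss-stable models are the coherent supported interpretations: coherence bounds `Cn` of the
reduct from above, support bounds it from below. -/
theorem mem_PSM_iff [Finite Q] {P : Set (Rule A × Q)} {I : Set (A × Q)} (hI : Functional I) :
    I ∈ PSM P ↔ Coherent P I ∧ Supported P I := by
  constructor
  · intro h
    have hcut : ∀ b q, q ∈ relGe I b ↔ Derivable P (proj I) b q := fun b q => by
      rw [← mem_relGe_Cn, ← show I = Cn (possReduct P (proj I)) from h]
    refine ⟨(coherent_iff hI).2 fun x hx hneg b hb hpos => ?_, fun p a hp =>
      (hcut a p).1 (mem_relGe_self hp)⟩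
    exact (hcut _ _).2 (.step x hx hneg hb fun p hp => (hcut _ _).1 (hpos hp))
  · rintro ⟨hc, hs⟩
    refine Below.antisymm hI (functional_Cn _) (fun p a hp => ?_)
      (below_iff_relGe.2 fun b q hq => ?_)
    · exact mem_relGe_Cn.2 (hs p a hp)
    · rw [mem_relGe_Cn] at hq
      rw [coherent_iff hI] at hc
      induction hq with
      | step x hx hneg hb _ ih => exact hc x hx hneg b hb ih

theorem functional_of_mem_PSM {P : Set (Rule A × Q)} {I : Set (A × Q)} (h : I ∈ PSM P) :
    Functional I := by
  rw [show I = Cn (possReduct P (proj I)) from h]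
  exact functional_Cn _

theorem eq_of_mem_PSM_of_subset [Finite Q] {P : Set (Rule A × Q)} {I J : Set (A × Q)}
    (hI : I ∈ PSM P) (hJ : J ∈ PSM P) (h : proj I ⊆ proj J) : I = J := by
  have hle : proj J ⊆ proj I := by
    rintro p ⟨a, ha⟩
    have hd := ((mem_PSM_iff (functional_of_mem_PSM hJ)).1 hJ).2 p a ha
    have := mem_relGe_Cn.2 (hd.mono (below_of_subset le_rfl) h le_rfl)
    rw [← show I = Cn (possReduct P (proj I)) from hI] at this
    exact relGe_subset_proj I a this
  rw [show I = Cn (possReduct P (proj I)) from hI, h.antisymm hle]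
  exact Eq.symm hJ

theorem eq_of_mem_PSM_of_comparable [Finite Q] {P : Set (Rule A × Q)} {I J : Set (A × Q)}
    (hI : I ∈ PSM P) (hJ : J ∈ PSM P) (h : Comparable I J) : I = J :=
  h.elim (eq_of_mem_PSM_of_subset hI hJ) fun h => (eq_of_mem_PSM_of_subset hJ hI h).symm

end Semantics

/-! ### Grounded programs and the positive solution space -/

section Grounding

variable {A : Type*}

theorem grounded_empty : Grounded (∅ : Set (Rule A)) :=
  ⟨[], List.nodup_nil, by simp, fun i => i.elim0⟩

theorem Grounded.insert {P : Set (Rule A)} (h : Grounded P) {r : Rule A} (hr : r ∉ P)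
    (hpos : ∀ p ∈ r.pos, ∃ s ∈ P, s.head = p) : Grounded (insert r P) := by
  obtain ⟨l, hnd, hmem, hl⟩ := h
  refine ⟨l ++ [r], ?_, fun s => ?_, ?_⟩
  · exact List.nodup_append.2 ⟨hnd, List.nodup_singleton r, fun a ha b hb => by
      rintro rfl
      exact hr ((hmem _).1 (List.mem_singleton.1 hb ▸ ha))⟩
  · simp [hmem, or_comm]
  · rintro ⟨i, hi⟩ p hp
    rw [List.length_append, List.length_singleton] at hi
    rcases Nat.lt_succ_iff_lt_or_eq.1 hi with h | rfl
    · rw [List.get_eq_getElem, List.getElem_append_left h] at hp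
      obtain ⟨⟨j, hj⟩, hji, hj'⟩ := hl ⟨i, h⟩ p hp
      exact ⟨⟨j, by simp; omega⟩, hji, by
        rw [List.get_eq_getElem, List.getElem_append_left hj]; exact hj'⟩
    · rw [List.get_eq_getElem, List.getElem_concat_length rfl] at hp
      obtain ⟨s, hs, rfl⟩ := hpos p hp
      obtain ⟨j, hj, rfl⟩ := List.getElem_of_mem ((hmem s).2 hs)
      exact ⟨⟨j, by simp; omega⟩, hj, by
        rw [List.get_eq_getElem, List.getElem_append_left hj]⟩

end Grounding

instance {A : Type*} [Finite A] : Finite (Rule A) :=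
  Finite.of_injective (fun r : Rule A => (r.head, r.pos, r.neg)) fun r s h => by
    simp only [Prod.mk.injEq] at h
    exact Rule.ext h.1 h.2.1 h.2.2

section PositiveSpace

variable {A Q : Type*} [LinearOrder Q]

theorem disjoint_neg_of_mem_posSpaceAt {I : Set (A × Q)} {e : A × Q} {x : Rule A × Q}
    (h : x ∈ posSpaceAt I e) : Disjoint (x.1.neg : Set A) (proj I) :=
  Set.subset_compl_iff_disjoint_right.1 h.2.2.1

theorem le_weight_of_mem_posSpaceAt {I : Set (A × Q)} {e : A × Q} {x : Rule A × Q}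
    (h : x ∈ posSpaceAt I e) : e.2 ≤ x.2 := by
  rcases h.2.2.2 with h | h
  exacts [h.2.ge, h.2]

theorem exists_mem_posSpaceAt_of_mem_posSpace {I : Set (A × Q)} {Y : Set (Rule A × Q)}
    (hY : Y ∈ posSpace I) {x : Rule A × Q} (hx : x ∈ Y) : ∃ e ∈ I, x ∈ posSpaceAt I e := by
  by_contra! h
  refine hY.2 ⟨Y \ {x}, ⟨Set.sdiff_subset, fun hle => (hle hx).2 rfl⟩, ?_⟩
  rintro _ ⟨e, he, rfl⟩
  obtain ⟨y, hy, hyY⟩ := hY.1 _ ⟨e, he, rfl⟩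
  refine ⟨y, hy, hyY, ?_⟩
  rintro rfl
  exact h e he hy

/-- Along the grounding sequence, every rule of a hitting set derives its head at the weight that
the head has in `I`. -/
theorem supported_of_mem_posSpace {I : Set (A × Q)} (hI : Functional I) {Y : Set (Rule A × Q)}
    (hY : Y ∈ posSpace I) (hg : Grounded (reduct (proj Y) (proj I))) : Supported Y I := by
  obtain ⟨l, -, hmem, hl⟩ := hg
  have key : ∀ n (hn : n < l.length) a, ((l[n]).head, a) ∈ I →
      Derivable Y (proj I) a (l[n]).head := by
    intro n
    induction n using Nat.strong_induction_on with
    | _ n ih =>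
      intro hn a ha
      obtain ⟨r, ⟨w, hr⟩, hneg, hd⟩ := (hmem _).1 (l.getElem_mem hn)
      obtain ⟨⟨p, a'⟩, he, hat⟩ := exists_mem_posSpaceAt_of_mem_posSpace hY hr
      have hhead : (l[n]).head = r.head := by rw [hd]; rfl
      have hp : r.head = p := hat.1
      rw [hhead] at ha ⊢
      obtain rfl : a = a' := hI p a a' (hp ▸ ha) he
      refine .step (r, w) hr hneg (le_weight_of_mem_posSpaceAt hat) fun c hc => ?_
      obtain ⟨d, hd', had⟩ := hat.2.1 hc
      obtain ⟨⟨j, hj⟩, hji, hjc⟩ := hl ⟨n, hn⟩ c (by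
        rw [List.get_eq_getElem, hd]; exact hc)
      rw [List.get_eq_getElem] at hjc
      have hji : j < n := hji
      subst hjc
      exact (ih j hji hj d hd').mono (below_of_subset le_rfl) le_rfl had
  intro p a hp
  obtain ⟨y, hy, hyY⟩ := hY.1 _ ⟨(p, a), hp, rfl⟩
  obtain ⟨n, hn, hn'⟩ := List.getElem_of_mem ((hmem y.1.definitePart).2
    ⟨y.1, ⟨y.2, hyY⟩, disjoint_neg_of_mem_posSpaceAt hy, rfl⟩)
  have hhead : (l[n]).head = p := by rw [hn']; exact hy.1
  rw [← hhead] at hp ⊢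
  exact key n hn a hp

/-- For a coherent interpretation, a rule that is applicable at the weight of its head belongs to
the positive solution space of the head. -/
theorem mem_posSpaceAt_of_coherent [Finite Q] {P : Set (Rule A × Q)} {I : Set (A × Q)}
    (hI : Functional I) (hc : Coherent P I) {x : Rule A × Q} (hx : x ∈ P) {a : Q}
    (ha : (x.1.head, a) ∈ I) (hneg : Disjoint (x.1.neg : Set A) (proj I)) (hle : a ≤ x.2)
    (hpos : (x.1.pos : Set A) ⊆ relGe I a) : x ∈ posSpaceAt I (x.1.head, a) := by
  refine ⟨rfl, hpos, Set.subset_compl_iff_disjoint_right.2 hneg, ?_⟩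
  by_cases h : (x.1.pos : Set A) ∩ relEq I a = ∅
  · refine Or.inl ⟨h, hle.antisymm' (not_lt.1 fun hlt => ?_)⟩
    -- All body atoms have weight above `a`, so the rule would violate coherence.
    refine Set.disjoint_left.1 ((coherent_iff_disjoint_negSpace hI).1 hc) hx
      (Or.inl (Set.mem_iUnion₂.2 ⟨_, ha, rfl, fun p hp => ?_,
        Set.subset_compl_iff_disjoint_right.2 hneg, hlt⟩))
    obtain ⟨b, hb, hab⟩ := hpos hp
    refine ⟨b, hb, lt_of_le_of_ne hab fun hab' => ?_⟩
    exact Set.notMem_empty p (h ▸ ⟨hp, b, hb, hab'.symm⟩)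
  · exact Or.inr ⟨h, hle⟩

variable [Finite A]

/-- A poss-stable model of `P` is supported by a grounded minimal hitting set inside `P` with at
most one rule per atom.  The hitting set is a maximal grounded set of rules of `P` with distinct
heads, taken from the positive solution spaces: if it missed an atom, it could be enlarged by a rule
for a missed atom of greatest weight. -/
theorem exists_grounded_of_mem_PSM [Finite Q] {P : Set (Rule A × Q)} {I : Set (A × Q)}
    (h : I ∈ PSM P) : ∃ Y ⊆ P, Y ∈ posSpace I ∧ Grounded (reduct (proj Y) (proj I)) ∧
      Y.ncard ≤ Nat.card A := by
  have hI := functional_of_mem_PSM h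
  obtain ⟨hc, hs⟩ := (mem_PSM_iff hI).1 h
  let Good : Set (Set (Rule A × Q)) := {Y | Y ⊆ P ∧ (∀ x ∈ Y, ∃ e ∈ I, x ∈ posSpaceAt I e) ∧
    Set.InjOn (fun x => x.1.head) Y ∧ Grounded (reduct (proj Y) (proj I))}
  have hempty : (∅ : Set (Rule A × Q)) ∈ Good := by
    refine ⟨Set.empty_subset _, by simp, by simp, ?_⟩
    convert grounded_empty (A := A)
    simp [reduct, proj]
  obtain ⟨Y, hYmax⟩ := Good.toFinite.exists_maximal ⟨∅, hempty⟩
  obtain ⟨hYP, hYat, hYinj, hYg⟩ := hYmax.prop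
  have hcover : ∀ p ∈ proj I, ∃ y ∈ Y, y.1.head = p := by
    by_contra! hmiss
    -- Pick a missed atom of greatest weight.
    obtain ⟨a, ⟨p, hp, hpY⟩, hamax⟩ := exists_isGreatest
      (s := {a | ∃ p, (p, a) ∈ I ∧ ∀ y ∈ Y, y.1.head ≠ p}) (by
        obtain ⟨p, ⟨a, ha⟩, hp⟩ := hmiss
        exact ⟨a, p, ha, hp⟩)
    have key : ∀ q, Derivable P (proj I) a q → q ∈ relGe I a ∧ ∃ y ∈ Y, y.1.head = q := by
      intro q hq
      induction hq with
      | step x hx hneg hle _ ih =>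
        have hposI : (x.1.pos : Set A) ⊆ relGe I a := fun q hq => (ih q hq).1
        have hheadI := (coherent_iff hI).1 hc x hx hneg a hle hposI
        refine ⟨hheadI, ?_⟩
        by_contra! hnew
        obtain ⟨b, hb, hab⟩ := hheadI
        obtain rfl : a = b := le_antisymm hab (hamax ⟨_, hb, hnew⟩)
        have hxat := mem_posSpaceAt_of_coherent hI hc hx hb hneg hle hposI
        have hxY : x ∉ Y := fun h => hnew x h rfl
        refine hxY (hYmax.le_of_ge (y := insert x Y) ?_ (Set.subset_insert x Y)
          (Set.mem_insert x Y))
        refine ⟨Set.insert_subset hx hYP, ?_, ?_, ?_⟩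
        · rintro z (rfl | hz)
          exacts [⟨_, hb, hxat⟩, hYat z hz]
        · rw [Set.injOn_insert hxY]
          refine ⟨hYinj, ?_⟩
          rintro ⟨z, hz, hzx⟩
          exact hnew z hz hzx
        · have hred : reduct (proj (insert x Y)) (proj I) =
              insert x.1.definitePart (reduct (proj Y) (proj I)) := by
            ext d
            constructor
            · rintro ⟨r, ⟨w, rfl | hr⟩, hn, rfl⟩
              exacts [Or.inl rfl, Or.inr ⟨r, ⟨w, hr⟩, hn, rfl⟩]
            · rintro (rfl | ⟨r, ⟨w, hr⟩, hn, rfl⟩)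
              exacts [⟨x.1, ⟨x.2, Or.inl rfl⟩, hneg, rfl⟩, ⟨r, ⟨w, Or.inr hr⟩, hn, rfl⟩]
          rw [hred]
          refine hYg.insert ?_ fun q hq => ?_
          · rintro ⟨r, ⟨w, hr⟩, -, he⟩
            exact hnew (r, w) hr (congrArg Rule.head he).symm
          · obtain ⟨y, hy, hyq⟩ := (ih q hq).2
            obtain ⟨e, -, hye⟩ := hYat y hy
            exact ⟨y.1.definitePart, ⟨y.1, ⟨y.2, hy⟩, disjoint_neg_of_mem_posSpaceAt hye, rfl⟩,
              hyq⟩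
    obtain ⟨y, hy, hyp⟩ := (key p (hs p a hp)).2
    exact hpY y hy hyp
  refine ⟨Y, hYP, ⟨?_, ?_⟩, hYg, ?_⟩
  · rintro _ ⟨⟨p, a⟩, hp, rfl⟩
    obtain ⟨y, hy, rfl⟩ := hcover p ⟨a, hp⟩
    obtain ⟨⟨q, b⟩, he, hye⟩ := hYat y hy
    obtain rfl : y.1.head = q := hye.1
    obtain rfl := hI _ a b hp he
    exact ⟨y, hye, hy⟩
  · rintro ⟨Z, ⟨hZY, hZne⟩, hZ⟩
    refine hZne fun y hy => ?_
    obtain ⟨e, he, hye⟩ := hYat y hy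
    obtain ⟨z, hze, hz⟩ := hZ _ ⟨e, he, rfl⟩
    rwa [hYinj hy (hZY hz) (hye.1.trans hze.1.symm)]
  · rw [← hYinj.ncard_image]
    exact (Set.ncard_le_ncard (Set.subset_univ _)).trans (Set.ncard_univ A).le

end PositiveSpace

/-! ### Least models of the classic reduct -/

section Bottom

variable {A Q : Type*} [LinearOrder Q]

theorem Derivable.mem_lfp {P R : Set (Rule A × Q)} {b : Q}
    (hR : ∀ x ∈ R, x.1.neg = ∅ → x ∈ P) {q : A} (h : Derivable R Set.univ b q) :
    q ∈ (consequence (reduct (proj P) Set.univ)).lfp := by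
  induction h with
  | step x hx hneg _ _ ih =>
    rw [← OrderHom.map_lfp]
    have hneg' : x.1.neg = ∅ := by simpa using hneg
    exact ⟨_, ⟨x.1, ⟨x.2, hR x hx hneg'⟩, hneg, rfl⟩, ih, rfl⟩

theorem derivable_of_mem_lfp {P R : Set (Rule A × Q)} {b : Q} (hb : ∀ c, b ≤ c)
    (hP : Below P R) {q : A} (h : q ∈ (consequence (reduct (proj P) Set.univ)).lfp) :
    Derivable R Set.univ b q := by
  have hle : (consequence (reduct (proj P) Set.univ)).lfp ≤ {q | Derivable R Set.univ b q} := by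
    refine OrderHom.lfp_le _ ?_
    rintro _ ⟨_, ⟨r, ⟨w, hw⟩, hneg, rfl⟩, hpos, rfl⟩
    obtain ⟨w', hw', -⟩ := hP r w hw
    exact Derivable.step (r, w') hw' hneg (hb w') fun p hp => hpos hp
  exact hle h

end Bottom

/-! ### Canonical supporting and blocking programs -/

section Canonical

variable {A Q : Type*}

/-- The program that justifies every atom of `I` by a rule without positive body whose negative body
consists of all the atoms outside of `I`. -/
def canonicalSupport (I : Set (A × Q)) : Set (Rule A × Q) :=
  {x | (x.1.head, x.2) ∈ I ∧ x.1.pos = ∅ ∧ (x.1.neg : Set A) = (proj I)ᶜ}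

/-- The rules of weight `c` that derive an atom outside of `e` and whose body holds in an
interpretation exactly if its atoms are those of `e`. -/
def blockers (c : Q) (e : Set (A × Q)) : Set (Rule A × Q) :=
  {x | x.1.head ∉ proj e ∧ (x.1.pos : Set A) = proj e ∧ (x.1.neg : Set A) = (proj e)ᶜ ∧ x.2 = c}

variable [LinearOrder Q]

theorem supported_canonicalSupport [Finite A] (I : Set (A × Q)) :
    Supported (canonicalSupport I) I := by
  intro p a hp
  refine Derivable.step (⟨p, ∅, (Set.toFinite (proj I)ᶜ).toFinset⟩, a) ⟨hp, rfl, by simp⟩ ?_ le_rfl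
    (by simp)
  simpa using disjoint_compl_left

theorem disjoint_canonicalSupport_negSpace {I J : Set (A × Q)} (hI : Functional I)
    (h : proj J ⊆ proj I → J = I) : Disjoint (canonicalSupport I) (negSpace J) := by
  rw [Set.disjoint_left]
  rintro x ⟨hx, -, hneg⟩ hn
  have hJ : J = I := h <| by
    rcases hn with hn | hn
    · obtain ⟨e, -, hxe⟩ := Set.mem_iUnion₂.1 hn
      exact Set.compl_subset_compl.1 (hneg ▸ hxe.2.2.1)
    · exact Set.compl_subset_compl.1 (hneg ▸ hn.2.2)
  subst hJ
  rcases hn with hn | hn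
  · obtain ⟨⟨p, a⟩, he, rfl, -, -, hlt⟩ := Set.mem_iUnion₂.1 hn
    exact absurd (hI _ _ _ he hx) hlt.ne
  · exact hn.1 ⟨_, hx⟩

theorem comparable_of_mem_blockers_of_mem_negSpace {c : Q} {e J : Set (A × Q)} {x : Rule A × Q}
    (hx : x ∈ blockers c e) (hJ : x ∈ negSpace J) : Comparable e J := by
  refine Or.inl (hx.2.1 ▸ ?_)
  rcases hJ with hn | hn
  · obtain ⟨e', -, hxe⟩ := Set.mem_iUnion₂.1 hn
    refine hxe.2.1.trans ?_
    rintro p ⟨b, hb, -⟩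
    exact ⟨b, hb⟩
  · exact hn.2.1

theorem exists_mem_blockers [Finite A] (c : Q) {e : Set (A × Q)} (he : proj e ≠ Set.univ) :
    ∃ x ∈ blockers c e, x ∈ negSpace e := by
  obtain ⟨q, hq⟩ := (Set.ne_univ_iff_exists_notMem _).1 he
  exact ⟨(⟨q, (Set.toFinite (proj e)).toFinset, (Set.toFinite (proj e)ᶜ).toFinset⟩, c),
    ⟨hq, by simp, by simp, rfl⟩, Or.inr ⟨hq, by simp, by simp⟩⟩

end Canonical

/-! ### Solvability -/

namespace Task

section Solvability

variable {A Q : Type*} [LinearOrder Q]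

theorem existence_iff (T : Task A Q) : T.existence = true ↔
    (∀ I ∈ T.Epos, ∀ J ∈ T.Epos, Comparable I J → I = J) ∧ (∀ I ∈ T.Epos, Coherent T.B I) ∧
      ¬ Incompatible T.B T.Eneg ∧ T.Epos ∩ T.Eneg = ∅ := by
  have h1 : (∃ I ∈ T.Epos, ∃ J ∈ T.Epos, I ≠ J ∧ Comparable I J) ↔
      ¬ ∀ I ∈ T.Epos, ∀ J ∈ T.Epos, Comparable I J → I = J := by
    push Not
    simp only [and_comm]
  have h2 : (∃ I ∈ T.Epos, ¬ Coherent T.B I) ↔ ¬ ∀ I ∈ T.Epos, Coherent T.B I := by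
    push Not
    rfl
  unfold existence
  rw [h1, h2]
  split_ifs <;> tauto

variable [Finite Q]

theorem existence_of_isSolution [Nonempty Q] {T : Task A Q} {H : Set (Rule A × Q)}
    (hH : T.IsSolution H) : T.existence = true := by
  obtain ⟨-, hpos, hneg⟩ := hH
  rw [existence_iff]
  refine ⟨fun I hI J hJ => eq_of_mem_PSM_of_comparable (hpos hI) (hpos hJ), fun I hI => ?_, ?_, ?_⟩
  · have hf := T.functional_Epos I hI
    exact ((mem_PSM_iff hf).1 (hpos hI)).1.of_below hf (below_join_left _ _)
  · rintro ⟨hlfp, -, hco⟩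
    -- With all atoms derivable, `Cn` of the reduct is a poss-stable model containing every atom.
    set R := join T.B H
    set G := Cn (possReduct R Set.univ) with hG
    obtain ⟨b, -, hb⟩ := exists_isLeast (Set.univ_nonempty (α := Q))
    have hfull : proj G = Set.univ := Set.eq_univ_of_forall fun q =>
      relGe_subset_proj G b (mem_relGe_Cn.2 (derivable_of_mem_lfp (fun c => hb trivial)
        (below_join_left _ _) (hlfp.symm.subset (Set.mem_univ q))))
    have hGR : G ∈ PSM R := by
      change G = Cn (possReduct R (proj G))
      rw [hfull]
    have hGf : Functional G := functional_Cn _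
    have hGE : G ∈ fullInterps A Q \ T.Eneg :=
      ⟨⟨hGf, hfull⟩, fun h => Set.notMem_empty G (hneg ▸ ⟨h, hGR⟩)⟩
    rcases hco with hco | hco
    · exact Set.notMem_empty G (hco ▸ hGE)
    · exact hco G hGE (((mem_PSM_iff hGf).1 hGR).1.of_below hGf (below_join_left _ _))
  · refine Set.eq_empty_of_forall_notMem fun I hI => ?_
    exact Set.notMem_empty I (hneg ▸ ⟨hI.2, hpos hI.1⟩)

theorem disjoint_blacklist_iff {T : Task A Q} {P : Set (Rule A × Q)} :
    Disjoint P T.blacklist ↔ ∀ I ∈ T.Epos, Coherent P I := by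
  rw [blacklist, Set.disjoint_iUnion₂_right]
  exact forall₂_congr fun I hI => (coherent_iff_disjoint_negSpace (T.functional_Epos I hI)).symm

/-- A program that avoids the blacklist and supports the positive examples makes them poss-stable,
on top of a background that is coherent with them. -/
theorem Epos_subset_PSM {T : Task A Q} (hB : ∀ I ∈ T.Epos, Coherent T.B I)
    {R : Set (Rule A × Q)} (hR : Disjoint R T.blacklist) (hs : ∀ I ∈ T.Epos, Supported R I) :
    T.Epos ⊆ PSM (join T.B R) := by
  intro I hI
  have hf := T.functional_Epos I hI
  refine (mem_PSM_iff hf).2 ⟨?_, (hs I hI).mono (below_join_right _ _)⟩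
  refine (coherent_iff_disjoint_negSpace hf).2 (Disjoint.mono_left (join_subset_union _ _) ?_)
  exact Set.disjoint_union_left.2 ⟨(coherent_iff_disjoint_negSpace hf).1 (hB I hI),
    (coherent_iff_disjoint_negSpace hf).1 (disjoint_blacklist_iff.1 hR I hI)⟩

/-- Removing from `R` what the background already provides does not change the join with the
background. -/
theorem isSolution_diff {T : Task A Q} (hB : ∀ I ∈ T.Epos, Coherent T.B I)
    {R : Set (Rule A × Q)} (hf : Functional R) (hR : Disjoint R T.blacklist)
    (hs : ∀ I ∈ T.Epos, Supported R I) (hneg : ∀ e ∈ T.Eneg, e ∉ PSM (join T.B R)) :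
    T.IsSolution (diff R T.B) := by
  refine ⟨hf.mono (diff_subset _ _), ?_⟩
  rw [join_diff T.functional_B hf]
  exact ⟨Epos_subset_PSM hB hR hs, Set.eq_empty_of_forall_notMem fun e he => hneg e he.1 he.2⟩

theorem not_comparable_of_mem_PSM {T : Task A Q} (hd : T.Epos ∩ T.Eneg = ∅)
    {R : Set (Rule A × Q)} (hpos : T.Epos ⊆ PSM R) {e : Set (A × Q)} (he : e ∈ T.Eneg)
    (heR : e ∈ PSM R) : ∀ I ∈ T.Epos, ¬ Comparable e I := by
  intro I hI hc
  obtain rfl := eq_of_mem_PSM_of_comparable heR (hpos hI) hc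
  exact Set.notMem_empty e (hd ▸ ⟨hI, he⟩)

/-- A task that passes the existence test is solvable. In general the canonical supports of the
positive examples together with blockers of the negative ones do; only a negative example with all
atoms cannot be blocked, and then either some other full interpretation can be made poss-stable or
the rules of the background do not derive all atoms. -/
theorem exists_isSolution_of_existence [Finite A] [Nonempty Q] {T : Task A Q}
    (hT : T.existence = true) : ∃ H, T.IsSolution H := by
  obtain ⟨hinc, hB, hcomp, hd⟩ := T.existence_iff.1 hT
  by_cases hG : T.Epos = ∅ ∧ ∃ G ∈ fullInterps A Q \ T.Eneg, Coherent T.B G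
  · obtain ⟨hE, G, ⟨⟨hGf, hGfull⟩, hGE⟩, hGB⟩ := hG
    have hfun : Functional (canonicalSupport G) := by
      rintro x a b ⟨ha, -⟩ ⟨hb, -⟩
      exact hGf _ a b ha hb
    refine ⟨_, isSolution_diff hB hfun (by simp [blacklist, hE]) (by simp [hE]) ?_⟩
    intro e he heR
    have hGR : G ∈ PSM (join T.B (canonicalSupport G)) := by
      refine (mem_PSM_iff hGf).2 ⟨?_, (supported_canonicalSupport G).mono (below_join_right _ _)⟩
      refine (coherent_iff_disjoint_negSpace hGf).2
        (Disjoint.mono_left (join_subset_union _ _) (Set.disjoint_union_left.2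
          ⟨(coherent_iff_disjoint_negSpace hGf).1 hGB,
            disjoint_canonicalSupport_negSpace hGf fun _ => rfl⟩))
    have := eq_of_mem_PSM_of_subset heR hGR (hGfull ▸ Set.subset_univ _)
    exact hGE (this ▸ he)
  · obtain ⟨c⟩ := ‹Nonempty Q›
    let X : Set (Rule A × Q) := bigJoin fun I : T.Epos => canonicalSupport I.1
    let P : Set (Rule A × Q) :=
      {x | ∃ e ∈ T.Eneg, (∀ I ∈ T.Epos, ¬ Comparable e I) ∧ x ∈ blockers c e}
    have hX : Functional X := functional_bigJoin _
    have hP : Functional P := by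
      rintro x a b ⟨_, _, _, _, _, _, rfl⟩ ⟨_, _, _, _, _, _, h⟩
      exact h.symm
    have hXb : Disjoint X T.blacklist := by
      refine Disjoint.mono_left (bigJoin_subset_iUnion _) (Set.disjoint_iUnion_left.2 fun I => ?_)
      refine Set.disjoint_iUnion₂_right.2 fun J hJ => ?_
      exact disjoint_canonicalSupport_negSpace (T.functional_Epos I.1 I.2) fun h =>
        hinc J hJ I.1 I.2 (Or.inl h)
    have hPb : Disjoint P T.blacklist := by
      rw [Set.disjoint_left]
      rintro x ⟨e, -, hinc, hx⟩ hb
      obtain ⟨J, hJ, hxJ⟩ := Set.mem_iUnion₂.1 hb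
      exact hinc J hJ (comparable_of_mem_blockers_of_mem_negSpace hx hxJ)
    have hR : Disjoint (join X P) T.blacklist :=
      Disjoint.mono_left (join_subset_union _ _) (Set.disjoint_union_left.2 ⟨hXb, hPb⟩)
    have hs : ∀ I ∈ T.Epos, Supported (join X P) I := fun I hI =>
      (supported_canonicalSupport I).mono
        ((below_bigJoin (fun I : T.Epos => canonicalSupport I.1) ⟨I, hI⟩).trans
          (below_join_left _ _))
    refine ⟨_, isSolution_diff hB (hX.join hP) hR hs fun e he heR => ?_⟩
    have hef := T.functional_Eneg e he
    have heE := not_comparable_of_mem_PSM hd (Epos_subset_PSM hB hR hs) he heR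
    obtain ⟨hco, hsu⟩ := (mem_PSM_iff hef).1 heR
    by_cases hfull : proj e = Set.univ
    · have hE : T.Epos = ∅ := Set.eq_empty_of_forall_notMem fun I hI =>
        heE I hI (Or.inr (hfull ▸ Set.subset_univ _))
      have hfe : e ∈ fullInterps A Q := ⟨hef, hfull⟩
      refine hcomp ⟨Set.eq_univ_of_forall fun q => ?_, fun h => (h ▸ hfe).2 he,
        Or.inr fun G hG' hGB => hG ⟨hE, G, hG', hGB⟩⟩
      obtain ⟨a, ha⟩ : q ∈ proj e := hfull ▸ Set.mem_univ q
      have hq := hsu q a ha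
      rw [hfull] at hq
      -- Every rule outside of the background has a nonempty negative body.
      refine hq.mem_lfp fun x hx hxneg => ?_
      rcases join_subset_union _ _ hx with hx | hx
      · exact hx
      exfalso
      rcases join_subset_union _ _ hx with hx | ⟨e', -, -, hhead, -, hneg, -⟩
      · obtain ⟨I, -⟩ := Set.mem_iUnion.1 (bigJoin_subset_iUnion _ hx)
        exact Set.notMem_empty I.1 (hE ▸ I.2)
      · rw [hxneg, Finset.coe_empty] at hneg
        exact Set.notMem_empty _ (hneg ▸ hhead : x.1.head ∈ (∅ : Set A))
    · obtain ⟨x, hx, hxe⟩ := exists_mem_blockers c hfull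
      have hPe : Coherent P e :=
        hco.of_below hef ((below_join_right X P).trans (below_join_right _ _))
      exact Set.disjoint_left.1 ((coherent_iff_disjoint_negSpace hef).1 hPe) ⟨e, he, heE, hx⟩ hxe

end Solvability

/-! ### Seeds and patches -/

section Candidates

variable {A Q : Type*} [LinearOrder Q] [Finite Q]

/-- Only the critical negative examples have to be tested: the others are comparable with a
poss-stable model or violate coherence already without the patch. -/
theorem isSolution_of_critical {T : Task A Q} (hT : T.existence = true) {X P : Set (Rule A × Q)}
    (hX : Functional X) (hP : Functional P) (hXb : Disjoint X T.blacklist)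
    (hPb : Disjoint P T.blacklist) (hs : ∀ I ∈ T.Epos, Supported X I)
    (hcrit : ∀ e ∈ T.critical X, e ∉ PSM (join (join T.B X) P)) :
    T.IsSolution (diff (join X P) T.B) := by
  obtain ⟨-, hB, -, hd⟩ := T.existence_iff.1 hT
  have hR : Disjoint (join X P) T.blacklist :=
    Disjoint.mono_left (join_subset_union _ _) (Set.disjoint_union_left.2 ⟨hXb, hPb⟩)
  have hs' : ∀ I ∈ T.Epos, Supported (join X P) I := fun I hI =>
    (hs I hI).mono (below_join_left _ _)
  refine isSolution_diff hB (hX.join hP) hR hs' fun e he heR => ?_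
  rw [join_assoc T.functional_B hX hP] at hcrit
  have hef := T.functional_Eneg e he
  refine hcrit e ⟨he, not_comparable_of_mem_PSM hd (Epos_subset_PSM hB hR hs') he heR,
    ((mem_PSM_iff hef).1 heR).1.of_below hef ?_⟩ heR
  exact join_below (below_join_left _ _) ((below_join_left X P).trans (below_join_right _ _))

/-- Every solution, joined with the background, contains a seed with at most `|A|` rules per
positive example. -/
theorem exists_seed_subset [Finite A] {T : Task A Q} {H : Set (Rule A × Q)} (hH : T.IsSolution H) :
    ∃ X ∈ T.seeds, X ⊆ join T.B H ∧ X.ncard ≤ T.Epos.ncard * Nat.card A := by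
  have hf := T.functional_B.join hH.1
  have hbl : Disjoint (join T.B H) T.blacklist := disjoint_blacklist_iff.2 fun I hI =>
    ((mem_PSM_iff (T.functional_Epos I hI)).1 (hH.2.1 hI)).1
  have hY := fun I : T.Epos => exists_grounded_of_mem_PSM (hH.2.1 I.2)
  choose Y hYR hYpos hYg hYc using hY
  refine ⟨bigJoin Y, ?_, (bigJoin_subset_iUnion Y).trans (Set.iUnion_subset hYR), ?_⟩
  · by_cases hE : T.Epos = ∅
    · refine Or.inl ⟨hE, Set.eq_empty_of_forall_notMem fun x hx => ?_⟩
      obtain ⟨I, -⟩ := Set.mem_iUnion.1 (bigJoin_subset_iUnion _ hx)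
      exact Set.notMem_empty I.1 (hE ▸ I.2)
    · exact Or.inr ⟨hE, Y, fun I => Or.inl ⟨hYpos I,
        Set.disjoint_iff_inter_eq_empty.1 (hbl.mono_left (hYR I)), hYg I⟩, rfl⟩
  · have := Fintype.ofFinite T.Epos
    have h1 := Set.ncard_le_ncard (bigJoin_subset_iUnion Y) (Set.toFinite _)
    have h2 := Finset.set_ncard_biUnion_le Finset.univ Y
    have h3 : ∑ I : T.Epos, (Y I).ncard ≤ T.Epos.ncard * Nat.card A := by
      refine (Finset.sum_le_card_nsmul _ _ _ fun I _ => hYc I).trans ?_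
      rw [Finset.card_univ, ← Nat.card_eq_fintype_card, Nat.card_coe_set_eq, smul_eq_mul]
    simp only [Finset.mem_univ, Set.iUnion_true] at h2
    exact h1.trans (h2.trans h3)

/-- In a solvable task every positive example has a supporting program, so that the empty program
never stands in for one in a seed. -/
theorem seed_spec [Finite A] {T : Task A Q} {H : Set (Rule A × Q)} (hH : T.IsSolution H)
    {X : Set (Rule A × Q)} (hX : X ∈ T.seeds) :
    Functional X ∧ Disjoint X T.blacklist ∧ ∀ I ∈ T.Epos, Supported X I := by
  rcases hX with ⟨hE, rfl⟩ | ⟨-, Y, hY, rfl⟩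
  · exact ⟨fun _ _ _ h => h.elim, Set.empty_disjoint _, by simp [hE]⟩
  have hbl : Disjoint (join T.B H) T.blacklist := disjoint_blacklist_iff.2 fun I hI =>
    ((mem_PSM_iff (T.functional_Epos I hI)).1 (hH.2.1 hI)).1
  have hY' : ∀ I : T.Epos, Y I ∈ T.supports I.1 := fun I => (hY I).resolve_right fun h => by
    obtain ⟨Z, hZ, hZpos, hZg, -⟩ := exists_grounded_of_mem_PSM (hH.2.1 I.2)
    exact Set.notMem_empty Z (h.1 ▸
      ⟨hZpos, Set.disjoint_iff_inter_eq_empty.1 (hbl.mono_left hZ), hZg⟩)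
  refine ⟨functional_bigJoin Y, Disjoint.mono_left (bigJoin_subset_iUnion Y)
    (Set.disjoint_iUnion_left.2 fun I => Set.disjoint_iff_inter_eq_empty.2 (hY' I).2.1),
    fun I hI => ?_⟩
  exact (supported_of_mem_posSpace (T.functional_Epos I hI) (hY' ⟨I, hI⟩).1
    (hY' ⟨I, hI⟩).2.2).mono (below_bigJoin Y ⟨I, hI⟩)

/-- If a seed inside a solution leaves some negative example poss-stable, then the solution contains
a patch of it: one rule for each critical negative example that the solution makes incoherent. The
other critical negative examples are not supported by the solution, hence by no part of it. -/
theorem exists_patch_subset [Finite A] [Nonempty Q] {T : Task A Q} {H X : Set (Rule A × Q)}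
    (hH : T.IsSolution H) (hX : X ∈ T.seeds) (hXH : X ⊆ join T.B H)
    (hbad : ∃ e ∈ T.Eneg, e ∈ PSM (join T.B X)) :
    ∃ P ⊆ join T.B H, ∃ j, 1 ≤ j ∧ j ≤ (T.critical X).ncard ∧ P ∈ T.patches X j ∧
      ∀ e ∈ T.critical X, e ∉ PSM (join (join T.B X) P) := by
  obtain ⟨-, hB, -, hd⟩ := T.existence_iff.1 (existence_of_isSolution hH)
  obtain ⟨hXf, hXb, hXs⟩ := seed_spec hH hX
  set R := join T.B H with hRdef
  have hRf : Functional R := T.functional_B.join hH.1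
  have hbl : Disjoint R T.blacklist := disjoint_blacklist_iff.2 fun I hI =>
    ((mem_PSM_iff (T.functional_Epos I hI)).1 (hH.2.1 hI)).1
  have hBX : Below (join T.B X) R := join_below (below_join_left _ _) (below_of_subset hXH)
  have hviol : ∀ e : {e | e ∈ T.critical X ∧ ¬ Coherent R e}, ∃ x ∈ R, x ∈ negSpace e.1 := by
    rintro ⟨e, he, hinc⟩
    rw [coherent_iff_disjoint_negSpace (T.functional_Eneg e he.1)] at hinc
    exact Set.not_disjoint_iff.1 hinc
  choose z hzR hze using hviol
  have hPR : Set.range z ⊆ R := Set.range_subset_iff.2 hzR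
  refine ⟨Set.range z, hPR, (Set.range z).ncard, ?_, ?_, ⟨hRf.mono hPR, ?_, rfl⟩, ?_⟩
  · obtain ⟨e, he, heX⟩ := hbad
    have hef := T.functional_Eneg e he
    obtain ⟨hco, hsu⟩ := (mem_PSM_iff hef).1 heX
    have hcrit : e ∈ T.critical X :=
      ⟨he, not_comparable_of_mem_PSM hd (Epos_subset_PSM hB hXb hXs) he heX, hco⟩
    have hinc : ¬ Coherent R e := fun h => Set.notMem_empty e
      (hH.2.2 ▸ ⟨he, (mem_PSM_iff hef).2 ⟨h, hsu.mono hBX⟩⟩)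
    have : Nonempty {e | e ∈ T.critical X ∧ ¬ Coherent R e} := ⟨⟨e, hcrit, hinc⟩⟩
    exact (Set.ncard_pos (Set.toFinite _)).2 (Set.range_nonempty z)
  · rw [← Set.image_univ]
    refine (Set.ncard_image_le (Set.toFinite _)).trans ?_
    rw [Set.ncard_univ, Nat.card_coe_set_eq]
    exact Set.ncard_le_ncard (fun e he => he.1) (Set.toFinite _)
  · rintro _ ⟨e, rfl⟩
    exact ⟨e.1, e.2.1, hze e, fun h => Set.disjoint_left.1 hbl (hzR e) h⟩
  · intro e he heP
    have hef := T.functional_Eneg e he.1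
    obtain ⟨hco, hsu⟩ := (mem_PSM_iff hef).1 heP
    by_cases hR : Coherent R e
    · refine Set.notMem_empty e (hH.2.2 ▸ ⟨he.1, (mem_PSM_iff hef).2 ⟨hR, hsu.mono ?_⟩⟩)
      exact join_below hBX (below_of_subset hPR)
    · have := (coherent_iff_disjoint_negSpace hef).1 (hco.of_below hef (below_join_right _ _))
      let e' : {e | e ∈ T.critical X ∧ ¬ Coherent R e} := ⟨e, he, hR⟩
      exact Set.disjoint_left.1 this (Set.mem_range_self e') (hze e')

end Candidates
end Task

/-! ### Loops -/

section Loops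

variable {α σ : Type*} {body : α → σ → σ → Prop}

theorem exists_forList (h : ∀ a s, ∃ t, body a s t) (l : List α) (s : σ) :
    ∃ t, ForList body l s t := by
  induction l generalizing s with
  | nil => exact ⟨s, rfl⟩
  | cons a l ih =>
    obtain ⟨u, hu⟩ := h a s
    obtain ⟨t, ht⟩ := ih u
    exact ⟨t, u, hu, ht⟩

theorem exists_forEach (h : ∀ a s, ∃ t, body a s t) {S : Set α} (hS : S.Finite) (s : σ) :
    ∃ t, ForEach body S s t := by
  obtain ⟨t, ht⟩ := exists_forList h hS.toFinset.toList s
  exact ⟨t, _, hS.toFinset.nodup_toList, by simp, ht⟩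

variable {R : σ → σ → Prop}

theorem ForList.rel (hrefl : ∀ s, R s s) (htrans : ∀ s t u, R s t → R t u → R s u) {l : List α}
    (hbody : ∀ a ∈ l, ∀ s t, body a s t → R s t) {s t : σ} (h : ForList body l s t) : R s t := by
  induction l generalizing s with
  | nil => exact (show t = s from h) ▸ hrefl s
  | cons a l ih =>
    obtain ⟨u, hu, ht⟩ := h
    exact htrans s u t (hbody a List.mem_cons_self s u hu)
      (ih (fun b hb => hbody b (List.mem_cons_of_mem a hb)) ht)

/-- If all passes of a loop respect a preorder, the pass for a given element lies between the
initial and the final state. -/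
theorem ForList.exists_pass (hrefl : ∀ s, R s s) (htrans : ∀ s t u, R s t → R t u → R s u)
    {l : List α} (hbody : ∀ a ∈ l, ∀ s t, body a s t → R s t) {s t : σ}
    (h : ForList body l s t) {a : α} (ha : a ∈ l) : ∃ u v, R s u ∧ body a u v ∧ R v t := by
  induction l generalizing s with
  | nil => simp at ha
  | cons b l ih =>
    have hbody' : ∀ a ∈ l, ∀ s t, body a s t → R s t :=
      fun c hc => hbody c (List.mem_cons_of_mem b hc)
    obtain ⟨w, hw, ht⟩ := h
    rcases List.mem_cons.1 ha with rfl | ha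
    · exact ⟨s, w, hrefl s, hw, ForList.rel hrefl htrans hbody' ht⟩
    · obtain ⟨u, v, hu, huv, hv⟩ := ih hbody' ht ha
      exact ⟨u, v, htrans s w u (hbody b List.mem_cons_self s w hw) hu, huv, hv⟩

theorem ForEach.rel (hrefl : ∀ s, R s s) (htrans : ∀ s t u, R s t → R t u → R s u) {S : Set α}
    (hbody : ∀ a ∈ S, ∀ s t, body a s t → R s t) {s t : σ} (h : ForEach body S s t) : R s t := by
  obtain ⟨l, -, hl, h⟩ := h
  exact h.rel hrefl htrans fun a ha => hbody a ((hl a).1 ha)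

theorem ForEach.exists_pass (hrefl : ∀ s, R s s) (htrans : ∀ s t u, R s t → R t u → R s u)
    {S : Set α} (hbody : ∀ a ∈ S, ∀ s t, body a s t → R s t) {s t : σ}
    (h : ForEach body S s t) {a : α} (ha : a ∈ S) : ∃ u v, R s u ∧ body a u v ∧ R v t := by
  obtain ⟨l, -, hl, h⟩ := h
  exact h.exists_pass hrefl htrans (fun a ha => hbody a ((hl a).1 ha)) ((hl a).2 ha)

end Loops

/-! ### Correctness of ILPSMmin -/

namespace Task

variable {A Q : Type*} [LinearOrder Q]

/-- The invariant of the main loop: either nothing has been found yet, or the hypothesis is a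
solution and `norm` is its number of rules. -/
def Sound (T : Task A Q) (s : State A Q) : Prop :=
  s.norm = T.initial.norm ∨ (T.IsSolution s.hyp ∧ s.norm = s.hyp.ncard)

/-- The preorder on states along which the algorithm moves: `norm` does not grow and the loop
invariant is preserved. -/
def Progress (T : Task A Q) (s t : State A Q) : Prop :=
  t.norm ≤ s.norm ∧ (T.Sound s → T.Sound t)

theorem Progress.refl (T : Task A Q) (s : State A Q) : T.Progress s s := ⟨le_rfl, id⟩

theorem Progress.trans (T : Task A Q) (s t u : State A Q) (h : T.Progress s t)
    (h' : T.Progress t u) : T.Progress s u :=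
  ⟨h'.1.trans h.1, h'.2 ∘ h.2⟩

theorem exists_seedStep [Finite A] [Finite Q] (T : Task A Q) (X : Set (Rule A × Q))
    (s : State A Q) : ∃ t, T.seedStep X s t := by
  unfold seedStep
  split_ifs
  · exact ⟨_, rfl⟩
  · exact ⟨_, rfl⟩
  · refine exists_forList (fun j s => ?_) _ s
    exact exists_forEach (body := T.patchStep X) (fun P s => ⟨_, rfl⟩)
      (Set.toFinite (T.patches X j)) s

theorem disjoint_blacklist_of_mem_patches {T : Task A Q} {X P : Set (Rule A × Q)} {j : ℕ}
    (hP : P ∈ T.patches X j) : Disjoint P T.blacklist := by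
  rw [Set.disjoint_left]
  intro x hx
  obtain ⟨e, -, -, h⟩ := hP.2.1 hx
  exact h

variable [Finite A] [Finite Q] {T : Task A Q} {H : Set (Rule A × Q)}

theorem patchStep_progress [Nonempty Q] (hH : T.IsSolution H) {X P : Set (Rule A × Q)}
    (hX : X ∈ T.seeds) {j : ℕ} (hP : P ∈ T.patches X j) {s t : State A Q}
    (h : T.patchStep X P s t) : T.Progress s t := by
  obtain ⟨hXf, hXb, hXs⟩ := seed_spec hH hX
  unfold patchStep at h
  split_ifs at h with hc
  · subst h
    exact ⟨hc.1.le, fun _ => Or.inr ⟨isSolution_of_critical (existence_of_isSolution hH) hXf hP.1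
      hXb (disjoint_blacklist_of_mem_patches hP) hXs hc.2, rfl⟩⟩
  · exact h ▸ Progress.refl T s

theorem seedStep_progress [Nonempty Q] (hH : T.IsSolution H) {X : Set (Rule A × Q)}
    (hX : X ∈ T.seeds) {s t : State A Q} (h : T.seedStep X s t) : T.Progress s t := by
  obtain ⟨hXf, hXb, hXs⟩ := seed_spec hH hX
  have hB := (T.existence_iff.1 (existence_of_isSolution hH)).2.1
  unfold seedStep at h
  split_ifs at h with hneg hlt
  · subst h
    exact ⟨hlt.le, fun _ => Or.inr ⟨isSolution_diff hB hXf hXb hXs hneg, rfl⟩⟩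
  · exact h ▸ Progress.refl T s
  · exact h.rel (Progress.refl T) (Progress.trans T) fun j _ s t h =>
      h.rel (Progress.refl T) (Progress.trans T) fun P hP s t => patchStep_progress hH hX hP

/-- For every solution there is a seed whose pass makes `norm` at most the number of rules of the
solution and less than its start value. -/
theorem exists_seed_norm_le [Nonempty Q] (hH : T.IsSolution H) :
    ∃ X ∈ T.seeds, ∀ s t, T.seedStep X s t → t.norm ≤ H.ncard ∧ t.norm < T.initial.norm := by
  obtain ⟨X, hX, hXH, hXc⟩ := exists_seed_subset hH
  refine ⟨X, hX, fun s t h => ?_⟩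
  have bound : ∀ Y ⊆ join T.B H, Y.ncard ≤ T.Epos.ncard * Nat.card A + T.Eneg.ncard →
      ∀ n ≤ (diff Y T.B).ncard, n ≤ H.ncard ∧ n < T.initial.norm := by
    intro Y hY hYc n hn
    refine ⟨hn.trans (Set.ncard_le_ncard (diff_subset_of_subset_join T.functional_B hY)
      (Set.toFinite _)), ?_⟩
    exact Nat.lt_succ_of_le
      (hn.trans ((Set.ncard_le_ncard (diff_subset Y T.B) (Set.toFinite _)).trans hYc))
  unfold seedStep at h
  split_ifs at h with hneg hlt
  · exact bound X hXH (hXc.trans (Nat.le_add_right _ _)) _ (h ▸ le_rfl)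
  · exact bound X hXH (hXc.trans (Nat.le_add_right _ _)) _ (h ▸ not_lt.1 hlt)
  · push Not at hneg
    obtain ⟨P, hPH, j, hj, hj', hP, hcrit⟩ := exists_patch_subset hH hX hXH hneg
    have hpatch : ∀ i, ∀ P ∈ T.patches X i, ∀ s t, T.patchStep X P s t → T.Progress s t :=
      fun i P hP s t => patchStep_progress hH hX hP
    obtain ⟨u, v, -, huv, hvt⟩ := h.exists_pass (Progress.refl T) (Progress.trans T)
      (fun i _ s t h => h.rel (Progress.refl T) (Progress.trans T) (hpatch i))
      (List.mem_range'_1.2 ⟨hj, by omega⟩ : j ∈ _)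
    obtain ⟨u', v', -, huv', hvt'⟩ :=
      huv.exists_pass (Progress.refl T) (Progress.trans T) (hpatch j) hP
    refine bound (join X P) ((join_subset_union X P).trans (Set.union_subset hXH hPH)) ?_ _
      (hvt.1.trans (hvt'.1.trans ?_))
    · have h1 := Set.ncard_le_ncard (join_subset_union X P) (Set.toFinite _)
      have h2 := Set.ncard_union_le X P
      have h3 : (T.critical X).ncard ≤ T.Eneg.ncard :=
        Set.ncard_le_ncard (fun e he => he.1) (Set.toFinite _)
      have h4 := hP.2.2
      omega
    · unfold patchStep at huv'
      split_ifs at huv' with hc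
      · exact huv' ▸ le_rfl
      · exact huv' ▸ not_lt.1 fun hlt => hc ⟨hlt, hcrit⟩

theorem isMinimalSolution_of_forEach [Nonempty Q] (hH : T.IsSolution H) {t : State A Q}
    (h : ForEach T.seedStep T.seeds T.initial t) : T.IsMinimalSolution t.hyp := by
  have hstep : ∀ X ∈ T.seeds, ∀ s t, T.seedStep X s t → T.Progress s t :=
    fun X hX s t => seedStep_progress hH hX
  have hle : ∀ K, T.IsSolution K → t.norm ≤ K.ncard ∧ t.norm < T.initial.norm := by
    intro K hK
    obtain ⟨X, hX, hXK⟩ := exists_seed_norm_le hK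
    obtain ⟨u, v, -, huv, hvt⟩ :=
      h.exists_pass (Progress.refl T) (Progress.trans T) hstep hX
    exact ⟨hvt.1.trans (hXK u v huv).1, hvt.1.trans_lt (hXK u v huv).2⟩
  obtain ⟨hsol, hnorm⟩ := ((h.rel (Progress.refl T) (Progress.trans T) hstep).2
    (Or.inl rfl)).resolve_left (hle H hH).2.ne
  refine ⟨hsol, ?_⟩
  rintro ⟨K, hK, hlt⟩
  rw [hK.1.ncard_proj, hsol.1.ncard_proj, ← hnorm] at hlt
  exact absurd (hle K hK).1 hlt.not_ge

end Task

end PossLP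

theorem mainTheorem3 {A Q : Type*} [Finite A] [LinearOrder Q] [Finite Q] [Nonempty Q]
    (T : PossLP.Task A Q) :
    (∃ out, T.Returns out) ∧
    ∀ out, T.Returns out →
      (out = none ↔ ¬ ∃ H, T.IsSolution H) ∧
      ((∃ H, T.IsSolution H) → ∃ H, out = some H ∧ T.IsMinimalSolution H) := by
  unfold PossLP.Task.Returns
  by_cases hT : T.existence = true
  · obtain ⟨H, hH⟩ := PossLP.Task.exists_isSolution_of_existence hT
    simp only [hT, if_true]
    constructor
    · obtain ⟨s, hs⟩ := PossLP.exists_forEach T.exists_seedStep T.seeds.toFinite T.initial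
      exact ⟨_, s, hs, rfl⟩
    · rintro _ ⟨s, hs, rfl⟩
      exact ⟨by simpa using ⟨H, hH⟩, fun _ =>
        ⟨_, rfl, PossLP.Task.isMinimalSolution_of_forEach hH hs⟩⟩
  · have hno : ¬ ∃ H, T.IsSolution H := fun ⟨H, hH⟩ =>
      hT (PossLP.Task.existence_of_isSolution hH)
    simp only [hT, Bool.false_eq_true, if_false]
    exact ⟨⟨none, rfl⟩, fun out hout => ⟨iff_of_true hout hno, fun h => absurd h hno⟩⟩
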